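/- Let $G=(V,E)$ be a finite connected simple graph with $N=|V|$ vertices, regarded as an electrical network in which every edge has unit resistance. For $u,v\in V$, let $W:V\to\mathbb{R}$ be a potential produced by a unit current entering at $u$ and leaving at $v$, that is, $\sum_{y:\{x,y\}\in E}(W_x-W_y)=\mathbf 1_{x=u}-\mathbf 1_{x=v}$ for all $x\in V$; such a $W$ exists and is unique up to an additive constant. Put $R_{\rm eff}(u,v)=W_u-W_v$ and $$R_{\rm ave}(G)=\frac{1}{2N^2}\sum_{u,v\in V}R_{\rm eff}(u,v).$$ For integers $d,M\ge 1$ let $T_{M^d}$ be the toroidal grid with vertex set $(\mathbb{Z}/M\mathbb{Z})^d$, in which two distinct vertices $x,y$ are adjacent if and only if $x-y=\pm e_j$ for some $j\in\{1,\dots,d\}$, where $e_j$ has entry $1$ in position $j$ and $0$ elsewhere. **Theorem (Asymptotics).** 1. $R_{\rm ave}(T_{M^2})\sim\dfrac{1}{2\pi}\ln M$ as $M\to+\infty$. 2. For every $d\ge 3$ the limit $L_d=\lim_{M\to+\infty}R_{\rm ave}(T_{M^d})$ exists and is finite, and $L_d=\Theta(1/d)$ as $d\to+\infty$; that is, there are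 constants $0<c\le C$ and $d_0\ge 3$ such that $c/d\le L_d\le C/d$ for all $d\ge d_0$. -/

import Mathlib

namespace ToroidalGrid

/-- `W` is a potential on the electrical network `G` (unit resistance on every edge) when a unit
current enters at `u` and a unit current leaves at `v`. By Ohm's law the current from `x` to an
adjacent vertex `y` is `W x - W y`; by Kirchhoff's law the total current that flows out of `x` along
the edges equals the external current injected at `x`. -/
def IsPotential {V : Type*} [Fintype V] (G : SimpleGraph V) (u v : V) (W : V → ℝ) : Prop :=
  open Classical in
  ∀ x : V, ∑ y ∈ G.neighborFinset x, (W x - W y) =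
    (if x = u then (1 : ℝ) else 0) - (if x = v then (1 : ℝ) else 0)

open Classical in
/-- Effective resistance: `W u - W v` for a potential `W`. On a connected graph a potential exists
(`exists_isPotential`) and the difference does not depend on its choice
(`effectiveResistance_eq`). -/
noncomputable def effectiveResistance {V : Type*} [Fintype V] (G : SimpleGraph V) (u v : V) : ℝ :=
  if h : ∃ W : V → ℝ, IsPotential G u v W then h.choose u - h.choose v else 0

/-- Average effective resistance `(1 / (2 N ^ 2)) * ∑_{u, v} R_eff(u, v)`, with `N` vertices. -/
noncomputable def averageResistance {V : Type*} [Fintype V] (G : SimpleGraph V) : ℝ :=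
  1 / (2 * (Fintype.card V : ℝ) ^ 2) * ∑ u : V, ∑ v : V, effectiveResistance G u v

/-- The toroidal grid on `ℤ / M 0 × ⋯ × ℤ / M (d - 1)`: distinct vertices `x`, `y` are adjacent when
`x - y = ± e j` for some `j`. -/
def torus {d : ℕ} (M : Fin d → ℕ+) : SimpleGraph (∀ i : Fin d, ZMod (M i)) where
  Adj x y := x ≠ y ∧ ∃ j : Fin d, x - y = Pi.single j 1 ∨ x - y = -Pi.single j 1
  symm := ⟨fun x y ⟨hne, j, h⟩ => ⟨hne.symm, j, by
    rcases h with h | h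
    · right; rw [← h, neg_sub]
    · left; rw [← neg_sub x y, h, neg_neg]⟩⟩
  loopless := ⟨fun _ h => h.1 rfl⟩

/-- The toroidal grid in `d` dimensions with all side lengths equal to `M`. -/
abbrev cubicTorus (d : ℕ) (M : ℕ+) : SimpleGraph (∀ _ : Fin d, ZMod M) :=
  torus (fun _ => M)

open Classical in
theorem isPotential_iff {V : Type*} [Fintype V] (G : SimpleGraph V) (u v : V) (W : V → ℝ) :
    IsPotential G u v W ↔ (G.lapMatrix ℝ).mulVec W = Pi.single u 1 - Pi.single v 1 := by
  rw [funext_iff]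
  refine forall_congr' fun x => ?_
  rw [SimpleGraph.lapMatrix_mulVec_apply]
  simp [Pi.single_apply, Finset.sum_sub_distrib]

theorem exists_isPotential {V : Type*} [Fintype V] (G : SimpleGraph V) (hG : G.Connected)
    (u v : V) : ∃ W : V → ℝ, IsPotential G u v W := by
  classical
  have : Nonempty V := ⟨u⟩
  have hcol (W : V → ℝ) : ∑ x, (G.lapMatrix ℝ).mulVec W x = 0 := by
    have : dotProduct (fun _ : V => (1 : ℝ)) ((G.lapMatrix ℝ).mulVec W) = 0 := by
      rw [Matrix.dotProduct_mulVec, ← Matrix.mulVec_transpose, (G.isSymm_lapMatrix (R := ℝ)).eq,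
        G.lapMatrix_mulVec_const_eq_zero, zero_dotProduct]
    simpa [dotProduct] using this
  let f : (V → ℝ) →ₗ[ℝ] (V → ℝ) :=
    { toFun := fun W x => (G.lapMatrix ℝ).mulVec W x + ∑ y, W y
      map_add' := fun a b => by
        ext x; simp [Matrix.mulVec_add, Finset.sum_add_distrib]; ring
      map_smul' := fun r a => by
        ext x; simp [Matrix.mulVec_smul, Finset.mul_sum, mul_add] }
  have hf (W : V → ℝ) (x : V) : f W x = (G.lapMatrix ℝ).mulVec W x + ∑ y, W y := rfl
  have hN : (Fintype.card V : ℝ) ≠ 0 := by exact_mod_cast Fintype.card_ne_zero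
  have hsum (W : V → ℝ) (h : ∑ x, f W x = 0) : ∑ y, W y = 0 := by
    simp only [hf, Finset.sum_add_distrib, hcol] at h
    simpa [hN] using h
  have hinj : Function.Injective f := by
    rw [injective_iff_map_eq_zero]
    intro W hW
    have h0 := hsum W (by simp [hW])
    have hL : (G.lapMatrix ℝ).mulVec W = 0 := by
      ext x
      have := congrFun hW x
      rwa [hf, h0, add_zero] at this
    rw [G.lapMatrix_mulVec_eq_zero_iff_forall_reachable] at hL
    ext x
    have hc : ∑ y, W y = Fintype.card V * W x := by
      rw [Finset.sum_congr rfl fun y _ => hL y x (hG.preconnected y x)]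
      simp
    rw [h0] at hc
    simpa [hN] using hc.symm
  obtain ⟨W, hW⟩ := (LinearMap.injective_iff_surjective.1 hinj) (Pi.single u 1 - Pi.single v 1)
  refine ⟨W, (isPotential_iff G u v W).2 ?_⟩
  have h0 := hsum W (by simp [hW])
  ext x
  rw [← hW, hf, h0, add_zero]

theorem effectiveResistance_eq {V : Type*} [Fintype V] (G : SimpleGraph V) (u v : V) (W : V → ℝ)
    (hW : IsPotential G u v W) : effectiveResistance G u v = W u - W v := by
  classical
  have h : ∃ W : V → ℝ, IsPotential G u v W := ⟨W, hW⟩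
  rw [effectiveResistance, dif_pos h]
  have h1 := (isPotential_iff G u v _).1 h.choose_spec
  have h2 := (isPotential_iff G u v W).1 hW
  set U := h.choose
  have key : dotProduct U ((G.lapMatrix ℝ).mulVec W) = dotProduct W ((G.lapMatrix ℝ).mulVec U) := by
    rw [Matrix.dotProduct_mulVec, ← Matrix.mulVec_transpose, (G.isSymm_lapMatrix (R := ℝ)).eq,
      dotProduct_comm]
  rw [h1, h2, dotProduct_sub, dotProduct_sub] at key
  simpa using key

theorem torus_connected {d : ℕ} (M : Fin d → ℕ+) : (torus M).Connected := by
  have step (x : ∀ i, ZMod (M i)) (j : Fin d) : (torus M).Reachable x (x + Pi.single j 1) := by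
    by_cases h : x = x + Pi.single j 1
    · rw [← h]
    · exact SimpleGraph.Adj.reachable ⟨h, j, Or.inr (by simp)⟩
  have steps (n : ℕ) (x : ∀ i, ZMod (M i)) (j : Fin d) :
      (torus M).Reachable x (x + Pi.single j (n : ZMod (M j))) := by
    induction n with
    | zero => simp
    | succ n ih =>
      refine ih.trans ?_
      have := step (x + Pi.single j (n : ZMod (M j))) j
      rwa [add_assoc, ← Pi.single_add, ← Nat.cast_succ] at this
  have reach (y : ∀ i, ZMod (M i)) (s : Finset (Fin d)) :
      (torus M).Reachable 0 (∑ i ∈ s, Pi.single i (y i)) := by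
    induction s using Finset.induction_on with
    | empty => simp
    | insert j s hj ih =>
      rw [Finset.sum_insert hj, add_comm]
      refine ih.trans ?_
      have := steps (y j).val (∑ i ∈ s, Pi.single i (y i)) j
      rwa [ZMod.natCast_zmod_val] at this
  have reach' (y : ∀ i, ZMod (M i)) : (torus M).Reachable 0 y := by
    simpa [Finset.univ_sum_single] using reach y Finset.univ
  exact ⟨fun x y => (reach' x).symm.trans (reach' y)⟩

end ToroidalGrid

/-! ### Fourier diagonalization of the Laplacian on the torus. -/

namespace ToroidalGrid

open Finset

/-! For `M ≥ 3` the characters of `(ℤ/M)^d` diagonalize the Laplacian, with eigenvalues `λ(h) = ∑ 4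
sin²(π h_j / M)`. Averaging effective resistances over pairs of vertices leaves `M^{-d} ∑_{h ≠ 0}
1/λ(h)` (`averageResistance_cubicTorus`); the convention `0⁻¹ = 0` drops the zero mode.

In dimension 2, `1/λ(h)` differs from `M²/(4π²|h|²)` by a bounded amount, where `|h|` uses distances
to 0 on the cycle (`inv_eigenvalue_two_bounds`). Comparing each row with an arctangent gives `∑_b
1/(a²+b²) ≈ π/(2a)`. Summing over `a` and over four quadrants yields `∑ |h|⁻² = 2π ln M + O(1)`
(`latticeSum_le`, `le_latticeSum`), so the average resistance is `ln M / (2π) + O(1)`.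

For `d ≥ 3` the average is exactly the integral over the unit cube of a step function that converges
to `1/λ` (`integral_floor_eq_sum`). With `y_j = min(x_j, 1 - x_j)`, the product of `y_j^{-2/d}`
controls all these step functions and is integrable because `2/d < 1`; dominated convergence gives
`L_d = ∫ 1/λ`. Since `λ ≤ 4d`, `L_d ≥ 1/(4d)`. By AM-GM, `λ ≥ 16 ∑ y_j² ≥ 16 d ∏ y_j^{2/d}`, which
gives an upper bound `C/d` once the integral of the majorant is bounded uniformly in `d`
(`integral_le_one_div`). -/

/-- The symbol of the Laplacian on `ℤ ^ ι`, in the frequency variable `x ∈ (ℝ / ℤ) ^ ι`. -/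
noncomputable def laplaceSymbol {ι : Type*} [Fintype ι] (x : ι → ℝ) : ℝ :=
  ∑ j, 4 * Real.sin (Real.pi * x j) ^ 2

/-- The eigenvalue of the Laplacian of the toroidal grid at the frequency `h`. -/
noncomputable def eigenvalue {d n : ℕ} (h : Fin d → ZMod n) : ℝ :=
  laplaceSymbol fun j => ((h j).val : ℝ) / n

theorem laplaceSymbol_nonneg {ι : Type*} [Fintype ι] (x : ι → ℝ) : 0 ≤ laplaceSymbol x :=
  Finset.sum_nonneg fun _ _ => by positivity

theorem laplaceSymbol_le {ι : Type*} [Fintype ι] (x : ι → ℝ) :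
    laplaceSymbol x ≤ 4 * Fintype.card ι := by
  refine (Finset.sum_le_card_nsmul _ _ 4 fun j _ => ?_).trans_eq ?_
  · nlinarith [Real.sin_sq_le_one (Real.pi * x j)]
  · simp [mul_comm]

theorem eigenvalue_zero {d n : ℕ} : eigenvalue (0 : Fin d → ZMod n) = 0 := by
  simp [eigenvalue, laplaceSymbol]

theorem eigenvalue_pos {d n : ℕ} [NeZero n] {h : Fin d → ZMod n} (hh : h ≠ 0) :
    0 < eigenvalue h := by
  obtain ⟨j, hj⟩ := Function.ne_iff.1 hh
  refine Finset.sum_pos' (fun _ _ => by positivity) ⟨j, mem_univ _, ?_⟩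
  have hn : (0 : ℝ) < n := by exact_mod_cast NeZero.pos n
  have h0 : (0 : ℝ) < (h j).val := by
    exact_mod_cast Nat.pos_of_ne_zero (by simpa [ZMod.val_eq_zero] using hj)
  have h1 : ((h j).val : ℝ) < n := by exact_mod_cast ZMod.val_lt (h j)
  have : 0 < Real.sin (Real.pi * ((h j).val / n : ℝ)) := by
    apply Real.sin_pos_of_pos_of_lt_pi
    · have := Real.pi_pos
      positivity
    · have : ((h j).val / n : ℝ) < 1 := (div_lt_one hn).2 h1
      nlinarith [Real.pi_pos]
  positivity

/-- The real part of the character of `(ℤ / n) ^ d` at the frequency `h`. -/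
noncomputable def realChar {d n : ℕ} [NeZero n] (h x : Fin d → ZMod n) : ℝ :=
  (ZMod.stdAddChar (h ⬝ᵥ x)).re

theorem realChar_comm {d n : ℕ} [NeZero n] (h x : Fin d → ZMod n) :
    realChar h x = realChar x h := by
  rw [realChar, dotProduct_comm, realChar]

theorem realChar_zero_right {d n : ℕ} [NeZero n] (h : Fin d → ZMod n) : realChar h 0 = 1 := by
  simp [realChar]

theorem realChar_zero_left {d n : ℕ} [NeZero n] (h : Fin d → ZMod n) : realChar 0 h = 1 := by
  simp [realChar]

theorem re_stdAddChar {n : ℕ} [NeZero n] (a : ZMod n) :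
    (ZMod.stdAddChar a).re = Real.cos (2 * Real.pi * (a.val / n)) := by
  rw [ZMod.stdAddChar_apply, ZMod.toCircle_apply,
    show (2 * Real.pi * Complex.I * (a.val : ℂ) / (n : ℂ) : ℂ) =
      ((2 * Real.pi * (a.val / n) : ℝ) : ℂ) * Complex.I by push_cast; ring,
    Complex.exp_ofReal_mul_I_re]

theorem re_stdAddChar_add_sub {n : ℕ} [NeZero n] (a b : ZMod n) :
    (ZMod.stdAddChar (a + b)).re + (ZMod.stdAddChar (a - b)).re =
      2 * (ZMod.stdAddChar a).re * (ZMod.stdAddChar b).re := by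
  have hb : ZMod.stdAddChar (-b) = starRingEnd ℂ (ZMod.stdAddChar b) := by
    rw [ZMod.stdAddChar_apply, ZMod.stdAddChar_apply, AddChar.map_neg_eq_inv,
      Circle.coe_inv_eq_conj]
  rw [sub_eq_add_neg, AddChar.map_add_eq_mul, AddChar.map_add_eq_mul, hb]
  simp only [Complex.mul_re, Complex.conj_re, Complex.conj_im]
  ring

/-- Orthogonality: for `x ≠ 0`, primitivity of the standard character makes `h ↦ stdAddChar (h ⬝ᵥ
x)` a nontrivial character, whose sum vanishes. -/
theorem sum_realChar {d n : ℕ} [NeZero n] (x : Fin d → ZMod n) :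
    ∑ h, realChar h x = if x = 0 then (n : ℝ) ^ d else 0 := by
  split_ifs with hx
  · simp [hx, realChar_zero_right]
  · let ψ : AddChar (Fin d → ZMod n) ℂ :=
      { toFun := fun h => ZMod.stdAddChar (h ⬝ᵥ x)
        map_zero_eq_one' := by simp
        map_add_eq_mul' := fun a b => by rw [add_dotProduct, AddChar.map_add_eq_mul] }
    have hψ : ψ ≠ 0 := by
      intro h0
      obtain ⟨j, hj⟩ := Function.ne_iff.1 hx
      refine (ZMod.isPrimitive_stdAddChar n hj) ?_
      ext a
      have := DFunLike.congr_fun h0 (Pi.single j a)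
      have h2 : ZMod.stdAddChar (Pi.single j a ⬝ᵥ x) = (1 : ℂ) := this
      rw [single_dotProduct] at h2
      rw [AddChar.mulShift_apply, mul_comm, h2, AddChar.one_apply]
    have := AddChar.sum_eq_zero_iff_ne_zero.2 hψ
    simpa [ψ, realChar] using congrArg Complex.re this

theorem realChar_add_sub_single {d n : ℕ} [NeZero n] (h x : Fin d → ZMod n) (j : Fin d) :
    2 * realChar h x - realChar h (x + Pi.single j 1) - realChar h (x - Pi.single j 1) =
      4 * Real.sin (Real.pi * ((h j).val / n)) ^ 2 * realChar h x := by
  have h1 : realChar h (x + Pi.single j 1) + realChar h (x - Pi.single j 1) =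
      2 * realChar h x * Real.cos (2 * Real.pi * ((h j).val / n)) := by
    rw [← re_stdAddChar]
    simpa [realChar, dotProduct_add, dotProduct_sub, dotProduct_single] using
      re_stdAddChar_add_sub (h ⬝ᵥ x) (h j)
  have h2 : Real.cos (2 * Real.pi * ((h j).val / n)) =
      1 - 2 * Real.sin (Real.pi * ((h j).val / n)) ^ 2 := by
    rw [mul_assoc, Real.cos_two_mul, Real.cos_sq']
    ring
  rw [h2] at h1
  linear_combination -h1

/-- From `M = 3` on, the `2d` vectors `± e_j` are nonzero and distinct. For `M = 2` the two signs
coincide, and for `M = 1` the vectors vanish. -/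
theorem sum_neighborFinset_cubicTorus {d : ℕ} {M : ℕ+} (hM : 3 ≤ (M : ℕ))
    (g : (Fin d → ZMod M) → ℝ) (x : Fin d → ZMod M)
    [Fintype ((cubicTorus d M).neighborSet x)] :
    ∑ y ∈ (cubicTorus d M).neighborFinset x, g y =
      ∑ j, (g (x + Pi.single j 1) + g (x - Pi.single j 1)) := by
  have : Fact (1 < (M : ℕ)) := ⟨by omega⟩
  have h11 : (1 : ZMod M) ≠ -1 := by
    have : Fact (2 < (M : ℕ)) := ⟨by omega⟩
    exact (ZMod.neg_one_ne_one (n := M)).symm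
  have key (j k : Fin d) (a b : ZMod M) (ha : a ≠ 0)
      (h : (Pi.single j a : Fin d → ZMod M) = Pi.single k b) : j = k ∧ a = b := by
    have h1 := congrFun h j
    rw [Pi.single_eq_same, Pi.single_apply] at h1
    split_ifs at h1 with hjk
    · exact ⟨hjk, h1⟩
    · exact absurd h1 ha
  let f : Fin d × Bool → (Fin d → ZMod M) := fun p => x + Pi.single p.1 (if p.2 then 1 else -1)
  have hs (b : Bool) : (if b then (1 : ZMod M) else -1) ≠ 0 := by cases b <;> simp
  have hR : ∑ j, (g (x + Pi.single j 1) + g (x - Pi.single j 1)) = ∑ p, g (f p) := by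
    rw [Fintype.sum_prod_type]
    simp [f, sub_eq_add_neg, Pi.single_neg]
  rw [hR]
  symm
  refine Finset.sum_nbij f ?_ ?_ ?_ fun _ _ => rfl
  · rintro ⟨j, b⟩ -
    rw [SimpleGraph.mem_neighborFinset]
    refine ⟨?_, j, ?_⟩
    · intro h
      have : (Pi.single j (if b then (1 : ZMod M) else -1) : Fin d → ZMod M) = 0 := by
        simpa [f] using h
      exact hs b (by simpa using this)
    · cases b <;> simp [f, Pi.single_neg]
  · rintro ⟨j, b⟩ - ⟨k, c⟩ - h
    obtain ⟨rfl, h2⟩ := key j k _ _ (hs b) (add_left_cancel h)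
    cases b <;> cases c <;> simp_all
  · intro y hy
    rw [mem_coe, SimpleGraph.mem_neighborFinset] at hy
    obtain ⟨-, j, h | h⟩ := hy
    · refine ⟨(j, false), by simp, ?_⟩
      simp only [f, Bool.false_eq_true, if_false, Pi.single_neg]
      rw [← h]; abel
    · refine ⟨(j, true), by simp, ?_⟩
      simp only [f, if_true]
      rw [← neg_eq_iff_eq_neg.2 h]; abel

theorem laplacian_realChar {d : ℕ} {M : ℕ+} (hM : 3 ≤ (M : ℕ)) (h x u : Fin d → ZMod M)
    [Fintype ((cubicTorus d M).neighborSet x)] :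
    ∑ y ∈ (cubicTorus d M).neighborFinset x, (realChar h (x - u) - realChar h (y - u)) =
      eigenvalue h * realChar h (x - u) := by
  rw [sum_neighborFinset_cubicTorus hM, eigenvalue, laplaceSymbol, Finset.sum_mul]
  refine Finset.sum_congr rfl fun j _ => ?_
  rw [← realChar_add_sub_single, add_sub_right_comm, sub_right_comm]
  ring

/-- This is the difference of Green's functions with poles at `u` and `v`. Applying the Laplacian
cancels each eigenvalue, and orthogonality turns the remaining character sums into point masses. -/
theorem isPotential_cubicTorus {d : ℕ} {M : ℕ+} (hM : 3 ≤ (M : ℕ)) (u v : Fin d → ZMod M) :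
    IsPotential (cubicTorus d M) u v fun x =>
      ((M : ℝ) ^ d)⁻¹ * ∑ h, (eigenvalue h)⁻¹ * (realChar h (x - u) - realChar h (x - v)) := by
  classical
  intro x
  have hM0 : ((M : ℝ) ^ d) ≠ 0 := by positivity
  simp_rw [← mul_sub, ← Finset.sum_sub_distrib, ← mul_sub]
  rw [← Finset.mul_sum, Finset.sum_comm]
  have h1 (h : Fin d → ZMod M) : ∑ y ∈ (cubicTorus d M).neighborFinset x,
      (eigenvalue h)⁻¹ * (realChar h (x - u) - realChar h (x - v) -
        (realChar h (y - u) - realChar h (y - v))) = realChar h (x - u) - realChar h (x - v) := by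
    rw [← Finset.mul_sum]
    rw [Finset.sum_congr rfl fun y _ => sub_sub_sub_comm _ _ _ _,
      Finset.sum_sub_distrib, laplacian_realChar hM, laplacian_realChar hM, ← mul_sub]
    -- At the zero mode nothing can be cancelled, but both sides vanish because the constant
    -- character takes equal values at `x - u` and `x - v`.
    by_cases hh : h = 0
    · simp [hh, realChar_zero_left]
    · rw [inv_mul_cancel_left₀ (eigenvalue_pos hh).ne']
  rw [Finset.sum_congr rfl fun h _ => h1 h, Finset.sum_sub_distrib, sum_realChar, sum_realChar]
  simp only [sub_eq_zero]
  rw [mul_sub]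
  congr 1 <;> split_ifs <;> simp

/-- The average resistance is the normalized trace of the inverse Laplacian. -/
theorem averageResistance_cubicTorus {d : ℕ} {M : ℕ+} (hM : 3 ≤ (M : ℕ)) :
    averageResistance (cubicTorus d M) =
      ((M : ℝ) ^ d)⁻¹ * ∑ h : Fin d → ZMod M, (eigenvalue h)⁻¹ := by
  have hM0 : ((M : ℝ) ^ d) ≠ 0 := by positivity
  have hR (u v : Fin d → ZMod M) : effectiveResistance (cubicTorus d M) u v =
      ((M : ℝ) ^ d)⁻¹ * ∑ h, (eigenvalue h)⁻¹ *
        (2 - realChar h (u - v) - realChar h (v - u)) := by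
    rw [effectiveResistance_eq _ _ _ _ (isPotential_cubicTorus hM u v), ← mul_sub,
      ← Finset.sum_sub_distrib]
    congr 1
    refine Finset.sum_congr rfl fun h _ => ?_
    rw [sub_self, sub_self, realChar_zero_right]
    ring
  -- Summation over `v` kills every nonzero mode, and `0⁻¹ = 0` kills the zero mode. Only the
  -- constant 2 in `hR` survives; it cancels the `1/2` in the average.
  have h1 (u h : Fin d → ZMod M) : (eigenvalue h)⁻¹ * ∑ v, realChar h (u - v) = 0 := by
    by_cases hh : h = 0
    · simp [hh, eigenvalue_zero]
    · rw [show ∑ v, realChar h (u - v) = ∑ v, realChar h v from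
        (Equiv.subLeft u).sum_comp (realChar h)]
      simp_rw [realChar_comm h]
      rw [sum_realChar, if_neg hh, mul_zero]
  have h2 (u h : Fin d → ZMod M) : (eigenvalue h)⁻¹ * ∑ v, realChar h (v - u) = 0 := by
    by_cases hh : h = 0
    · simp [hh, eigenvalue_zero]
    · rw [show ∑ v, realChar h (v - u) = ∑ v, realChar h v from
        (Equiv.subRight u).sum_comp (realChar h)]
      simp_rw [realChar_comm h]
      rw [sum_realChar, if_neg hh, mul_zero]
  have h3 (u : Fin d → ZMod M) : ∑ v, effectiveResistance (cubicTorus d M) u v =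
      2 * ∑ h : Fin d → ZMod M, (eigenvalue h)⁻¹ := by
    simp_rw [hR]
    rw [← Finset.mul_sum, Finset.sum_comm]
    simp_rw [mul_sub, Finset.sum_sub_distrib, ← Finset.mul_sum, h1, h2]
    simp only [sum_const, card_univ, Fintype.card_pi, ZMod.card, prod_const, Fintype.card_fin,
      nsmul_eq_mul, Nat.cast_pow, ← Finset.sum_mul, mul_zero]
    field_simp
    ring
  rw [averageResistance]
  simp_rw [h3]
  simp only [sum_const, card_univ, Fintype.card_pi, ZMod.card, prod_const, Fintype.card_fin,
      nsmul_eq_mul, Nat.cast_pow]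
  field_simp

end ToroidalGrid

/-! ### Dimension 2: lattice sums of `1/(a² + b²)` over a quadrant. -/

namespace ToroidalGrid

open Finset

theorem arctan_sub_arctan_mem_Icc {x y : ℝ} (hx : 0 ≤ x) (hxy : x < y) :
    Real.arctan y - Real.arctan x ∈ Set.Icc ((y - x) / (1 + y ^ 2)) ((y - x) / (1 + x ^ 2)) := by
  obtain ⟨c, ⟨hc1, hc2⟩, hc⟩ := exists_deriv_eq_slope Real.arctan hxy
    Real.continuous_arctan.continuousOn Real.differentiable_arctan.differentiableOn
  have hd : 0 < y - x := sub_pos.2 hxy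
  rw [Real.deriv_arctan, eq_div_iff hd.ne', one_div_mul_eq_div] at hc
  rw [← hc]
  exact ⟨by gcongr; linarith, by gcongr⟩

theorem arctan_le_of_nonneg {x : ℝ} (hx : 0 ≤ x) : Real.arctan x ≤ x := by
  rcases hx.eq_or_lt with rfl | hx
  · simp
  · simpa using (arctan_sub_arctan_mem_Icc le_rfl hx).2

/-- The term at `b` is at most the increment of `arctan(t/a)/a` over `[b-1, b]`, so the sum
telescopes. -/
theorem sum_inv_sq_add_sq_le {a : ℝ} (ha : 0 < a) (B : ℕ) :
    ∑ b ∈ Icc 1 B, (a ^ 2 + (b : ℝ) ^ 2)⁻¹ ≤ Real.pi / 2 * a⁻¹ := by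
  have h : ∑ b ∈ Icc 1 B, (a ^ 2 + (b : ℝ) ^ 2)⁻¹ ≤ Real.arctan (B / a) * a⁻¹ := by
    induction B with
    | zero => simp
    | succ B ih =>
      rw [Finset.sum_Icc_succ_top (by omega)]
      have h1 := (arctan_sub_arctan_mem_Icc (x := B / a) (y := (B + 1) / a) (by positivity)
        (by gcongr; linarith)).1
      have h2 : ((B + 1) / a - B / a) / (1 + ((B + 1) / a) ^ 2) * a⁻¹ =
          (a ^ 2 + ((B : ℝ) + 1) ^ 2)⁻¹ := by
        field_simp
        ring
      have h3 := mul_le_mul_of_nonneg_right h1 (inv_nonneg.2 ha.le)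
      rw [h2] at h3
      push_cast
      linarith
  exact h.trans (by gcongr; exact (Real.arctan_lt_pi_div_two _).le)

/-- The term at `b` is at least the increment of `arctan(t/a)/a` over `[b, b+1]`. The two subtracted
terms pay for the missing ends: the tail `π/2 - arctan((B+1)/a) ≤ a/(B+1)` and the start
`arctan(1/a) ≤ 1/a`. -/
theorem le_sum_inv_sq_add_sq {a : ℝ} (ha : 0 < a) (B : ℕ) :
    Real.pi / 2 * a⁻¹ - (B + 1 : ℝ)⁻¹ - (a ^ 2)⁻¹ ≤
      ∑ b ∈ Icc 1 B, (a ^ 2 + (b : ℝ) ^ 2)⁻¹ := by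
  have h : (Real.arctan ((B + 1) / a) - Real.arctan (1 / a)) * a⁻¹ ≤
      ∑ b ∈ Icc 1 B, (a ^ 2 + (b : ℝ) ^ 2)⁻¹ := by
    induction B with
    | zero => simp
    | succ B ih =>
      rw [Finset.sum_Icc_succ_top (by omega)]
      have h1 := (arctan_sub_arctan_mem_Icc (x := (B + 1) / a) (y := (B + 1 + 1) / a)
        (by positivity) (by gcongr; linarith)).2
      have h2 : ((B + 1 + 1) / a - (B + 1) / a) / (1 + ((B + 1) / a) ^ 2) * a⁻¹ =
          (a ^ 2 + ((B : ℝ) + 1) ^ 2)⁻¹ := by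
        field_simp
        ring
      have h3 := mul_le_mul_of_nonneg_right h1 (inv_nonneg.2 ha.le)
      rw [h2] at h3
      push_cast
      linarith
  refine le_trans ?_ h
  have h1 : Real.pi / 2 - a / (B + 1) ≤ Real.arctan ((B + 1) / a) := by
    have := Real.arctan_inv_of_pos (x := (B + 1) / a) (by positivity)
    rw [inv_div] at this
    have h2 := arctan_le_of_nonneg (x := a / (B + 1)) (by positivity)
    linarith
  have h2 := arctan_le_of_nonneg (x := 1 / a) (by positivity)
  calc Real.pi / 2 * a⁻¹ - (B + 1 : ℝ)⁻¹ - (a ^ 2)⁻¹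
      = (Real.pi / 2 - a / (B + 1) - 1 / a) * a⁻¹ := by field_simp
    _ ≤ _ := by gcongr ?_ * _; linarith

theorem sum_Icc_inv_sq_le_two (B : ℕ) : ∑ a ∈ Icc 1 B, ((a : ℝ) ^ 2)⁻¹ ≤ 2 := by
  have := sum_Ioo_inv_sq_le (α := ℝ) 0 (B + 1)
  have h : Ioo 0 (B + 1) = Icc 1 B := by ext; simp; omega
  rw [h] at this
  simpa using this

theorem sum_Icc_inv_eq_harmonic (B : ℕ) : ∑ a ∈ Icc 1 B, (a : ℝ)⁻¹ = (harmonic B : ℝ) := by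
  rw [harmonic_eq_sum_Icc]
  push_cast
  rfl

theorem double_sum_inv_le (B : ℕ) :
    ∑ a ∈ Icc 1 B, ∑ b ∈ Icc 1 B, ((a : ℝ) ^ 2 + (b : ℝ) ^ 2)⁻¹ ≤
      Real.pi / 2 * (1 + Real.log B) := by
  calc _ ≤ ∑ a ∈ Icc 1 B, Real.pi / 2 * (a : ℝ)⁻¹ := by
        refine Finset.sum_le_sum fun a ha => sum_inv_sq_add_sq_le ?_ B
        exact_mod_cast (Finset.mem_Icc.1 ha).1
    _ = Real.pi / 2 * (harmonic B : ℝ) := by rw [← Finset.mul_sum, sum_Icc_inv_eq_harmonic]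
    _ ≤ _ := by
      have := Real.pi_pos
      gcongr
      exact harmonic_le_one_add_log B

theorem le_double_sum_inv (B : ℕ) :
    -- The 3 collects the row errors: `B/(B+1) ≤ 1` and `∑ a⁻² ≤ 2`.
    Real.pi / 2 * Real.log (B + 1 : ℕ) - 3 ≤
      ∑ a ∈ Icc 1 B, ∑ b ∈ Icc 1 B, ((a : ℝ) ^ 2 + (b : ℝ) ^ 2)⁻¹ := by
  calc Real.pi / 2 * Real.log (B + 1 : ℕ) - 3
      ≤ Real.pi / 2 * (harmonic B : ℝ) - B * (B + 1 : ℝ)⁻¹ - 2 := by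
        have h1 : (B : ℝ) * (B + 1 : ℝ)⁻¹ ≤ 1 := by
          rw [← div_eq_mul_inv, div_le_one (by positivity)]
          linarith
        have h2 := mul_le_mul_of_nonneg_left (log_add_one_le_harmonic B)
          (show 0 ≤ Real.pi / 2 by positivity)
        linarith
    _ ≤ ∑ a ∈ Icc 1 B, (Real.pi / 2 * (a : ℝ)⁻¹ - (B + 1 : ℝ)⁻¹ - ((a : ℝ) ^ 2)⁻¹) := by
        rw [Finset.sum_sub_distrib, Finset.sum_sub_distrib, ← Finset.mul_sum,
          sum_Icc_inv_eq_harmonic]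
        have := sum_Icc_inv_sq_le_two B
        simp only [sum_const, Nat.card_Icc, Nat.add_sub_cancel, nsmul_eq_mul]
        linarith
    _ ≤ _ := by
        refine Finset.sum_le_sum fun a ha => le_sum_inv_sq_add_sq ?_ B
        exact_mod_cast (Finset.mem_Icc.1 ha).1

/-! ### Folding the cycle: sums over residues and sums over distances. -/

/-- The distance of a residue class from `0` in the cycle `ℤ / n`. -/
def cycleDist {n : ℕ} (k : ZMod n) : ℕ := min k.val (n - k.val)

theorem cycleDist_fiber_card_le {n : ℕ} [NeZero n] (a : ℕ) :
    #{k : ZMod n | cycleDist k = a} ≤ 2 := by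
  refine (card_le_card (t := {(a : ZMod n), -(a : ZMod n)}) fun k hk => ?_).trans card_le_two
  have hlt := ZMod.val_lt k
  rw [mem_filter] at hk
  have hk2 := hk.2
  rw [cycleDist] at hk2
  rw [mem_insert, mem_singleton]
  rcases le_total k.val (n - k.val) with h | h
  · left
    rw [min_eq_left h] at hk2
    rw [← hk2, ZMod.natCast_zmod_val]
  · right
    rw [min_eq_right h] at hk2
    rw [← hk2, Nat.cast_sub hlt.le, ZMod.natCast_zmod_val, ZMod.natCast_self, zero_sub, neg_neg]

/-- Each distance from 1 to `n / 2` is attained at most twice, by `± a`; for even `n` the antipode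
is attained only once. -/
theorem sum_cycleDist_le {n : ℕ} [NeZero n] {F : ℕ → ℝ} (hF : ∀ a, 0 ≤ F a) :
    ∑ k : ZMod n, F (cycleDist k) ≤ F 0 + 2 * ∑ a ∈ Icc 1 (n / 2), F a := by
  have hmem : ∀ k ∈ ({k : ZMod n | k ≠ 0} : Finset (ZMod n)), cycleDist k ∈ Icc 1 (n / 2) := by
    intro k hk
    have hk0 : k.val ≠ 0 := by simpa using hk
    have hlt := ZMod.val_lt k
    rw [cycleDist, mem_Icc]
    omega
  have h0 : ∑ k : ZMod n, F (cycleDist k) =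
      F 0 + ∑ k ∈ ({k : ZMod n | k ≠ 0} : Finset (ZMod n)), F (cycleDist k) := by
    rw [← Finset.sum_filter_add_sum_filter_not univ (fun k : ZMod n => k = 0)]
    congr 1
    rw [Finset.filter_eq' univ (0 : ZMod n)]
    simp [cycleDist]
  rw [h0, ← Finset.sum_fiberwise_of_maps_to hmem, Finset.mul_sum]
  gcongr with a ha
  refine (Finset.sum_le_card_nsmul _ _ (F a) fun k hk => ?_).trans ?_
  · rw [(Finset.mem_filter.1 hk).2]
  · rw [nsmul_eq_mul]
    refine mul_le_mul_of_nonneg_right ?_ (hF a)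
    refine le_trans ?_ (Nat.cast_le.2 (cycleDist_fiber_card_le (n := n) a))
    gcongr
    exact subset_univ _

/-- Stopping at `(n - 1) / 2` leaves out the antipode, so that `a` and `n - a` are distinct
residues. -/
theorem le_sum_cycleDist {n : ℕ} [NeZero n] {F : ℕ → ℝ} (hF : ∀ a, 0 ≤ F a) :
    2 * ∑ a ∈ Icc 1 ((n - 1) / 2), F a ≤ ∑ k : ZMod n, F (cycleDist k) := by
  have hn := NeZero.pos n
  let f : ℕ × Bool → ZMod n := fun p => if p.2 then (p.1 : ZMod n) else ((n - p.1 : ℕ) : ZMod n)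
  have hval (a : ℕ) (ha : a ∈ Icc 1 ((n - 1) / 2)) (b : Bool) :
      (f (a, b)).val = if b then a else n - a := by
    rw [mem_Icc] at ha
    cases b
    · simpa [f] using ZMod.val_cast_of_lt (show n - a < n by omega)
    · simpa [f] using ZMod.val_cast_of_lt (show a < n by omega)
  have hinj : Set.InjOn f (Icc 1 ((n - 1) / 2) ×ˢ (univ : Finset Bool) : Finset (ℕ × Bool)) := by
    rintro ⟨a, b⟩ ha ⟨a', b'⟩ ha' h
    simp only [coe_product, Set.mem_prod, mem_coe, mem_univ, and_true] at ha ha'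
    have h' := congrArg ZMod.val h
    rw [hval a ha, hval a' ha'] at h'
    rw [mem_Icc] at ha ha'
    cases b <;> cases b' <;> simp at h' ⊢ <;> omega
  calc 2 * ∑ a ∈ Icc 1 ((n - 1) / 2), F a
      = ∑ p ∈ Icc 1 ((n - 1) / 2) ×ˢ (univ : Finset Bool), F (cycleDist (f p)) := by
        rw [Finset.sum_product, Finset.mul_sum]
        refine Finset.sum_congr rfl fun a ha => ?_
        have hd (b : Bool) : cycleDist (f (a, b)) = a := by
          rw [cycleDist, hval a ha]
          rw [mem_Icc] at ha
          cases b <;> simp <;> omega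
        simp [hd, two_mul]
    _ = ∑ k ∈ (Icc 1 ((n - 1) / 2) ×ˢ (univ : Finset Bool)).image f, F (cycleDist k) :=
        (Finset.sum_image (f := fun k => F (cycleDist k)) hinj).symm
    _ ≤ _ := Finset.sum_le_sum_of_subset_of_nonneg (subset_univ _) fun _ _ _ => hF _

theorem sin_val_sq_eq_sin_cycleDist_sq {n : ℕ} [NeZero n] (k : ZMod n) :
    Real.sin (Real.pi * (k.val / n)) ^ 2 = Real.sin (Real.pi / n * cycleDist k) ^ 2 := by
  have hn : (n : ℝ) ≠ 0 := by exact_mod_cast NeZero.ne n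
  rw [cycleDist]
  rcases le_total k.val (n - k.val) with h | h
  · rw [min_eq_left h]
    congr 2
    ring
  · rw [min_eq_right h, Nat.cast_sub (ZMod.val_lt k).le,
      show Real.pi / n * ((n : ℝ) - k.val) = Real.pi - Real.pi * (k.val / n) by field_simp,
      Real.sin_pi_sub]

/-- Square `sin z ≥ z - z³/6`. The bound `z ≤ 2` keeps the right side nonnegative, as squaring
requires. -/
theorem sq_sub_pow_four_le_sin_sq {z : ℝ} (h0 : 0 ≤ z) (h1 : z ≤ 2) :
    z ^ 2 - z ^ 4 ≤ Real.sin z ^ 2 := by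
  rcases h0.eq_or_lt with rfl | h0
  · simp
  · have h2 := (Real.sin_gt_sub_cube h0).le
    have h3 : 0 ≤ z - z ^ 3 / 6 := by nlinarith [mul_nonneg h0.le h0.le]
    have h4 := pow_le_pow_left₀ h3 h2 2
    nlinarith [sq_nonneg (z ^ 3), sq_nonneg (z ^ 2)]

/-- Let `p` and `s` be the two sums of squares. The cubic bound on sine gives `1 - p ≤ s/p` and
Jordan's inequality gives `p ≤ (π²/4) s`; add them and divide by `s`. -/
theorem inv_sin_sq_add_sin_sq_le {z w : ℝ} (hz : 0 ≤ z) (hz' : z ≤ Real.pi / 2) (hw : 0 ≤ w)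
    (hw' : w ≤ Real.pi / 2) :
    (Real.sin z ^ 2 + Real.sin w ^ 2)⁻¹ ≤ (z ^ 2 + w ^ 2)⁻¹ + Real.pi ^ 2 / 4 := by
  have hpi := Real.pi_pos
  have hpi4 := Real.pi_le_four
  rcases (show 0 ≤ z ^ 2 + w ^ 2 by positivity).eq_or_lt with h | hp
  · have h1 : z = 0 := by nlinarith [sq_nonneg z, sq_nonneg w]
    have h2 : w = 0 := by nlinarith [sq_nonneg z, sq_nonneg w]
    subst h1 h2
    simp
    positivity
  have a1 := sq_sub_pow_four_le_sin_sq hz (by linarith)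
  have a2 := sq_sub_pow_four_le_sin_sq hw (by linarith)
  have b1 := pow_le_pow_left₀ (by positivity) (Real.mul_le_sin hz hz') 2
  have b2 := pow_le_pow_left₀ (by positivity) (Real.mul_le_sin hw hw') 2
  set p := z ^ 2 + w ^ 2 with hpdef
  set s := Real.sin z ^ 2 + Real.sin w ^ 2
  have hps : p - p ^ 2 ≤ s := by
    have : 0 ≤ z ^ 2 * w ^ 2 := by positivity
    simp only [hpdef, s]
    nlinarith
  have hs : 4 / Real.pi ^ 2 * p ≤ s := by
    have : 4 / Real.pi ^ 2 * p = (2 / Real.pi * z) ^ 2 + (2 / Real.pi * w) ^ 2 := by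
      rw [hpdef]; ring
    simp only [s]
    linarith
  have hs0 : 0 < s := lt_of_lt_of_le (by positivity) hs
  rw [inv_eq_one_div, div_le_iff₀ hs0]
  have h5 : p ≤ Real.pi ^ 2 / 4 * s := by
    calc p = Real.pi ^ 2 / 4 * (4 / Real.pi ^ 2 * p) := by field_simp
      _ ≤ _ := by gcongr
  have h6 : 1 - p ≤ p⁻¹ * s := by
    calc 1 - p = p⁻¹ * (p - p ^ 2) := by field_simp
      _ ≤ _ := by gcongr
  linarith

theorem le_inv_sin_sq_add_sin_sq {z w : ℝ} (hz : 0 ≤ z) (hz' : z ≤ Real.pi / 2) (hw : 0 ≤ w)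
    (hw' : w ≤ Real.pi / 2) :
    (z ^ 2 + w ^ 2)⁻¹ ≤ (Real.sin z ^ 2 + Real.sin w ^ 2)⁻¹ := by
  have hpi := Real.pi_pos
  rcases (show 0 ≤ z ^ 2 + w ^ 2 by positivity).eq_or_lt with h | hp
  · rw [← h]
    simp
    positivity
  have b1 := pow_le_pow_left₀ (by positivity) (Real.mul_le_sin hz hz') 2
  have b2 := pow_le_pow_left₀ (by positivity) (Real.mul_le_sin hw hw') 2
  have hs : 0 < 4 / Real.pi ^ 2 * (z ^ 2 + w ^ 2) := by positivity
  have hs' : 4 / Real.pi ^ 2 * (z ^ 2 + w ^ 2) = (2 / Real.pi * z) ^ 2 + (2 / Real.pi * w) ^ 2 := by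
    ring
  gcongr ?_⁻¹
  · linarith
  · exact add_le_add Real.sin_sq_le_sq Real.sin_sq_le_sq

theorem inv_eigenvalue_two_bounds {n : ℕ} [NeZero n] (k l : ZMod n) :
    (eigenvalue ![k, l])⁻¹ ∈ Set.Icc
      (n ^ 2 / (4 * Real.pi ^ 2) * ((cycleDist k : ℝ) ^ 2 + (cycleDist l : ℝ) ^ 2)⁻¹)
      (n ^ 2 / (4 * Real.pi ^ 2) * ((cycleDist k : ℝ) ^ 2 + (cycleDist l : ℝ) ^ 2)⁻¹ +
        Real.pi ^ 2 / 16) := by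
  have hn : (0 : ℝ) < n := by exact_mod_cast NeZero.pos n
  have hpi := Real.pi_pos
  have he : eigenvalue ![k, l] = 4 * (Real.sin (Real.pi / n * cycleDist k) ^ 2 +
      Real.sin (Real.pi / n * cycleDist l) ^ 2) := by
    simp only [eigenvalue, laplaceSymbol, Fin.sum_univ_two, Matrix.cons_val_zero,
      Matrix.cons_val_one, sin_val_sq_eq_sin_cycleDist_sq]
    ring
  have hle (k : ZMod n) : Real.pi / n * cycleDist k ≤ Real.pi / 2 := by
    have : 2 * cycleDist k ≤ n := by rw [cycleDist]; omega
    have : 2 * (cycleDist k : ℝ) ≤ n := by exact_mod_cast this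
    rw [div_mul_eq_mul_div, div_le_div_iff₀ hn two_pos]
    nlinarith
  have h1 := inv_sin_sq_add_sin_sq_le (z := Real.pi / n * cycleDist k)
    (w := Real.pi / n * cycleDist l) (by positivity) (hle k) (by positivity) (hle l)
  have h2 := le_inv_sin_sq_add_sin_sq (z := Real.pi / n * cycleDist k)
    (w := Real.pi / n * cycleDist l) (by positivity) (hle k) (by positivity) (hle l)
  have h3 : n ^ 2 / (4 * Real.pi ^ 2) * ((cycleDist k : ℝ) ^ 2 + (cycleDist l : ℝ) ^ 2)⁻¹ =
      4⁻¹ * ((Real.pi / n * cycleDist k) ^ 2 + (Real.pi / n * cycleDist l) ^ 2)⁻¹ := by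
    rw [mul_pow, mul_pow, ← mul_add, mul_inv, div_pow, inv_div]
    ring
  rw [he, mul_inv, h3]
  constructor <;> linarith

/-- The sum of `|h|⁻²` over the nonzero points `h` of `(ℤ / n)²`. -/
noncomputable def latticeSum (n : ℕ) [NeZero n] : ℝ :=
  ∑ k : ZMod n, ∑ l : ZMod n, ((cycleDist k : ℝ) ^ 2 + (cycleDist l : ℝ) ^ 2)⁻¹

theorem latticeSum_le {n : ℕ} [NeZero n] :
    latticeSum n ≤ 2 * Real.pi * (1 + Real.log n) + 8 := by
  set B := n / 2 with hB
  have inner (a : ℕ) : ∑ l : ZMod n, ((a : ℝ) ^ 2 + (cycleDist l : ℝ) ^ 2)⁻¹ ≤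
      ((a : ℝ) ^ 2)⁻¹ + 2 * ∑ b ∈ Icc 1 B, ((a : ℝ) ^ 2 + (b : ℝ) ^ 2)⁻¹ := by
    have := sum_cycleDist_le (n := n) (F := fun b => ((a : ℝ) ^ 2 + (b : ℝ) ^ 2)⁻¹)
      fun b => by positivity
    rwa [Nat.cast_zero, zero_pow two_ne_zero, add_zero] at this
  have outer := sum_cycleDist_le (n := n)
    (F := fun a => ∑ l : ZMod n, ((a : ℝ) ^ 2 + (cycleDist l : ℝ) ^ 2)⁻¹)
    fun a => Finset.sum_nonneg fun l _ => by positivity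
  have h0 : ∑ l : ZMod n, (((0 : ℕ) : ℝ) ^ 2 + (cycleDist l : ℝ) ^ 2)⁻¹ ≤ 4 := by
    refine (inner 0).trans ?_
    have := sum_Icc_inv_sq_le_two B
    simp only [Nat.cast_zero, ne_eq, OfNat.ofNat_ne_zero, not_false_eq_true, zero_pow, inv_zero,
      zero_add]
    linarith
  have h1 : ∑ a ∈ Icc 1 B, ∑ l : ZMod n, ((a : ℝ) ^ 2 + (cycleDist l : ℝ) ^ 2)⁻¹ ≤
      2 + 2 * (Real.pi / 2 * (1 + Real.log n)) := by
    refine (Finset.sum_le_sum fun a _ => inner a).trans ?_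
    -- The entries on the axis `b = 0` add at most 2, and the others twice the quadrant sum.
    rw [Finset.sum_add_distrib, ← Finset.mul_sum]
    have hlog : Real.log B ≤ Real.log n := by
      rcases Nat.eq_zero_or_pos B with h | h
      · rw [h]
        simpa using Real.log_natCast_nonneg n
      · exact Real.log_le_log (by exact_mod_cast h) (by exact_mod_cast Nat.div_le_self n 2)
    have h3 := double_sum_inv_le B
    have h4 := mul_le_mul_of_nonneg_left hlog (show 0 ≤ Real.pi / 2 by positivity)
    have := sum_Icc_inv_sq_le_two B
    linarith
  rw [latticeSum]
  refine outer.trans ?_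
  linarith

/-- Discard the axes and keep four quadrants, each losing at most 3. The term `log 2` comes from `B
+ 1 ≥ n / 2`. -/
theorem le_latticeSum {n : ℕ} [NeZero n] :
    2 * Real.pi * (Real.log n - Real.log 2) - 12 ≤ latticeSum n := by
  set B := (n - 1) / 2 with hB
  have inner (a : ℕ) : 2 * ∑ b ∈ Icc 1 B, ((a : ℝ) ^ 2 + (b : ℝ) ^ 2)⁻¹ ≤
      ∑ l : ZMod n, ((a : ℝ) ^ 2 + (cycleDist l : ℝ) ^ 2)⁻¹ :=
    le_sum_cycleDist (n := n) (F := fun b => ((a : ℝ) ^ 2 + (b : ℝ) ^ 2)⁻¹)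
      fun b => by positivity
  have outer := le_sum_cycleDist (n := n)
    (F := fun a => ∑ l : ZMod n, ((a : ℝ) ^ 2 + (cycleDist l : ℝ) ^ 2)⁻¹)
    fun a => Finset.sum_nonneg fun l _ => by positivity
  have h1 := Finset.sum_le_sum fun (a : ℕ) (_ : a ∈ Icc 1 B) => inner a
  rw [← Finset.mul_sum] at h1
  have hn : (0 : ℝ) < n := by exact_mod_cast NeZero.pos n
  have hlog : Real.log n - Real.log 2 ≤ Real.log (B + 1 : ℕ) := by
    rw [← Real.log_div hn.ne' two_ne_zero]
    refine Real.log_le_log (by positivity) ?_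
    rw [div_le_iff₀ two_pos]
    exact_mod_cast (show n ≤ (B + 1) * 2 by omega)
  have h3 := le_double_sum_inv B
  have h4 := mul_le_mul_of_nonneg_left hlog (show 0 ≤ Real.pi / 2 by positivity)
  refine le_trans ?_ outer
  linarith

theorem averageResistance_two_bounds {M : ℕ+} (hM : 3 ≤ (M : ℕ)) :
    averageResistance (cubicTorus 2 M) ∈ Set.Icc (1 / (4 * Real.pi ^ 2) * latticeSum M)
      (1 / (4 * Real.pi ^ 2) * latticeSum M + Real.pi ^ 2 / 16) := by
  have hM0 : (0 : ℝ) < (M : ℕ) := by positivity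
  have hsum : ∑ h : Fin 2 → ZMod M, (eigenvalue h)⁻¹ =
      ∑ k : ZMod M, ∑ l : ZMod M, (eigenvalue ![k, l])⁻¹ := by
    rw [← Fintype.sum_prod_type']
    exact ((finTwoArrowEquiv (ZMod M)).symm.sum_comp fun h => (eigenvalue h)⁻¹).symm
  rw [averageResistance_cubicTorus hM, hsum]
  have hpull : ((M : ℝ) ^ 2)⁻¹ * ∑ k : ZMod M, ∑ l : ZMod M, ((M : ℝ) ^ 2 / (4 * Real.pi ^ 2) *
      ((cycleDist k : ℝ) ^ 2 + (cycleDist l : ℝ) ^ 2)⁻¹) =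
      1 / (4 * Real.pi ^ 2) * latticeSum M := by
    simp_rw [← Finset.mul_sum, latticeSum]
    field_simp
  constructor
  · rw [← hpull]
    gcongr with k _ l _
    exact (inv_eigenvalue_two_bounds k l).1
  · have : ((M : ℝ) ^ 2)⁻¹ * ∑ k : ZMod M, ∑ l : ZMod M, ((M : ℝ) ^ 2 / (4 * Real.pi ^ 2) *
      ((cycleDist k : ℝ) ^ 2 + (cycleDist l : ℝ) ^ 2)⁻¹ + Real.pi ^ 2 / 16) =
      1 / (4 * Real.pi ^ 2) * latticeSum M + Real.pi ^ 2 / 16 := by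
      simp_rw [Finset.sum_add_distrib]
      rw [mul_add, hpull]
      simp only [sum_const, card_univ, ZMod.card, nsmul_eq_mul]
      field_simp
    rw [← this]
    gcongr with k _ l _
    exact (inv_eigenvalue_two_bounds k l).2

open Filter Asymptotics in
theorem averageResistance_two_isEquivalent :
    (fun M : ℕ+ => averageResistance (cubicTorus 2 M)) ~[atTop]
      fun M : ℕ+ => 1 / (2 * Real.pi) * Real.log (M : ℝ) := by
  have hpi := Real.pi_pos
  have hcast : Tendsto (fun M : ℕ+ => ((M : ℕ) : ℝ)) atTop atTop :=
    tendsto_natCast_atTop_atTop.comp tendsto_PNat_val_atTop_atTop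
  have hbig : (fun M : ℕ+ => averageResistance (cubicTorus 2 M) -
      1 / (2 * Real.pi) * Real.log (M : ℝ)) =O[atTop] fun _ => (1 : ℝ) := by
    -- One constant that covers both the upper error, from `latticeSum_le` and `π²/16`, and the
    -- lower error, from `le_latticeSum`.
    refine IsBigO.of_bound (1 / (4 * Real.pi ^ 2) * (2 * Real.pi * (1 + Real.log 2) + 12) +
      Real.pi ^ 2 / 16) ?_
    filter_upwards [eventually_ge_atTop (3 : ℕ+)] with M hM
    have hb := averageResistance_two_bounds (M := M) (by exact_mod_cast hM)
    have hc : 0 ≤ 1 / (4 * Real.pi ^ 2) := by positivity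
    have h1 := mul_le_mul_of_nonneg_left (latticeSum_le (n := M)) hc
    have h2 := mul_le_mul_of_nonneg_left (le_latticeSum (n := M)) hc
    have h3 : 1 / (2 * Real.pi) * Real.log (M : ℝ) =
        1 / (4 * Real.pi ^ 2) * (2 * Real.pi * Real.log (M : ℝ)) := by
      field_simp
      ring
    have hl2 : 0 ≤ 1 / (4 * Real.pi ^ 2) * (2 * Real.pi * Real.log 2) := by
      have := Real.log_nonneg one_le_two
      positivity
    have hp1 : 0 ≤ 1 / (4 * Real.pi ^ 2) * (2 * Real.pi) := by positivity
    have hp2 : 0 ≤ Real.pi ^ 2 := by positivity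
    rw [norm_one, mul_one, Real.norm_eq_abs, abs_le, h3]
    constructor
    · linarith [hb.1]
    · linarith [hb.2]
  refine hbig.trans_isLittleO ?_
  rw [isLittleO_const_left]
  right
  refine tendsto_norm_atTop_atTop.comp ?_
  exact (Real.tendsto_log_atTop.comp hcast).const_mul_atTop (by positivity)

end ToroidalGrid

/-! ### Dimension at least 3: Riemann sums and dominated convergence on the cube. -/

namespace ToroidalGrid

open Finset MeasureTheory

/-- Lebesgue measure on the open unit cube. -/
noncomputable def cubeMeasure (d : ℕ) : Measure (Fin d → ℝ) :=
  Measure.pi fun _ => volume.restrict (Set.Ioo (0 : ℝ) 1)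

instance isProbabilityMeasure_Ioo :
    IsProbabilityMeasure (volume.restrict (Set.Ioo (0 : ℝ) 1)) :=
  ⟨by simp⟩

instance isProbabilityMeasure_cubeMeasure (d : ℕ) : IsProbabilityMeasure (cubeMeasure d) := by
  unfold cubeMeasure
  infer_instance

theorem ae_mem_cube (d : ℕ) : ∀ᵐ x ∂cubeMeasure d, ∀ j, x j ∈ Set.Ioo (0 : ℝ) 1 := by
  have h := Measure.restrict_pi_pi (fun _ : Fin d => (volume : Measure ℝ))
    fun _ => Set.Ioo (0 : ℝ) 1
  rw [cubeMeasure, ← h]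
  filter_upwards [ae_restrict_mem (MeasurableSet.univ_pi fun _ => measurableSet_Ioo)] with x hx
  simpa using hx

theorem integral_floor_indicator {n k : ℕ} (hk : k < n) :
    ∫ s in Set.Ioo (0 : ℝ) 1, (if ⌊s * n⌋₊ = k then (1 : ℝ) else 0) = (n : ℝ)⁻¹ := by
  have hn : (0 : ℝ) < n := by exact_mod_cast (Nat.zero_le k).trans_lt hk
  have hk1 : (k : ℝ) + 1 ≤ n := by exact_mod_cast hk
  have hset : ∫ s in Set.Ioo (0 : ℝ) 1, (if ⌊s * n⌋₊ = k then (1 : ℝ) else 0) =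
      ∫ s in Set.Ico (0 : ℝ) 1, (Set.Ico (k / n : ℝ) ((k + 1) / n)).indicator (fun _ => 1) s := by
    rw [← setIntegral_congr_set (Ioo_ae_eq_Ico (a := (0 : ℝ)) (b := 1))]
    refine setIntegral_congr_fun measurableSet_Ioo fun s hs => ?_
    have h0 : 0 ≤ s * n := mul_nonneg hs.1.le hn.le
    simp only [Set.indicator_apply, Set.mem_Ico, Nat.floor_eq_iff h0, div_le_iff₀ hn,
      lt_div_iff₀ hn]
  have hsub : Set.Ico (k / n : ℝ) ((k + 1) / n) ⊆ Set.Ico (0 : ℝ) 1 :=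
    Set.Ico_subset_Ico (by positivity) ((div_le_one hn).2 hk1)
  rw [hset, setIntegral_indicator measurableSet_Ico, Set.inter_eq_right.2 hsub]
  have : (0 : ℝ) ≤ (k + 1) / n - k / n := by
    rw [← sub_div]
    simp
  rw [setIntegral_const, Measure.real, Real.volume_Ico, ENNReal.toReal_ofReal this, smul_eq_mul]
  field_simp
  ring

/-- The integrand is constant on each of the `n^d` cells of side `1/n`. Writing it through products
of one-dimensional indicators makes every cell contribute `n^{-d}`. -/
theorem integral_floor_eq_sum {d n : ℕ} [NeZero n] (F : (Fin d → ℕ) → ℝ) :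
    ∫ x, F (fun j => ⌊x j * n⌋₊) ∂cubeMeasure d =
      ((n : ℝ) ^ d)⁻¹ * ∑ h : Fin d → ZMod n, F fun j => (h j).val := by
  have hn : (0 : ℝ) < n := by exact_mod_cast NeZero.pos n
  have hae : (fun x : Fin d → ℝ => F (fun j => ⌊x j * n⌋₊)) =ᵐ[cubeMeasure d] fun x =>
      ∑ h : Fin d → ZMod n, (F fun j => (h j).val) *
        ∏ j, if ⌊x j * n⌋₊ = (h j).val then (1 : ℝ) else 0 := by
    filter_upwards [ae_mem_cube d] with x hx
    have hlt (j : Fin d) : ⌊x j * n⌋₊ < n := by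
      rw [Nat.floor_lt (mul_nonneg (hx j).1.le hn.le)]
      nlinarith [(hx j).2]
    have hval (j : Fin d) : ((⌊x j * n⌋₊ : ℕ) : ZMod n).val = ⌊x j * n⌋₊ :=
      ZMod.val_cast_of_lt (hlt j)
    rw [Finset.sum_eq_single fun j => ((⌊x j * n⌋₊ : ℕ) : ZMod n)]
    · simp [hval]
    · intro h _ hne
      obtain ⟨j, hj⟩ := Function.ne_iff.1 hne
      rw [Finset.prod_eq_zero (mem_univ j), mul_zero]
      rw [if_neg]
      intro h'
      exact hj (by rw [h', ZMod.natCast_zmod_val])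
    · simp
  have hmeas (k : ℕ) : Measurable fun s : ℝ => if ⌊s * n⌋₊ = k then (1 : ℝ) else 0 :=
    Measurable.ite
      ((Nat.measurable_floor.comp (measurable_id.mul_const _)) (measurableSet_singleton k))
      measurable_const measurable_const
  have hint (h : Fin d → ZMod n) : Integrable (fun x : Fin d → ℝ =>
      ∏ j, if ⌊x j * n⌋₊ = (h j).val then (1 : ℝ) else 0) (cubeMeasure d) := by
    unfold cubeMeasure
    refine Integrable.fintype_prod
      (f := fun j (s : ℝ) => if ⌊s * n⌋₊ = (h j).val then (1 : ℝ) else 0) fun j => ?_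
    refine Integrable.of_bound (hmeas _).aestronglyMeasurable 1 (ae_of_all _ fun s => ?_)
    split_ifs <;> simp
  have hI (h : Fin d → ZMod n) : ∫ x, ∏ j, (if ⌊x j * n⌋₊ = (h j).val then (1 : ℝ) else 0)
      ∂cubeMeasure d = ((n : ℝ) ^ d)⁻¹ := by
    rw [cubeMeasure, integral_fintype_prod_eq_prod
      (f := fun j (s : ℝ) => if ⌊s * n⌋₊ = (h j).val then (1 : ℝ) else 0)]
    simp [integral_floor_indicator (ZMod.val_lt (h _))]
  rw [integral_congr_ae hae, integral_finsetSum _ fun h _ => (hint h).const_mul _]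
  simp_rw [integral_const_mul, hI]
  rw [← Finset.sum_mul, mul_comm]

/-- An integrable majorant of `s ↦ (min s (1 - s)) ^ (-p)` on the unit interval. -/
noncomputable def edgeWeight (p s : ℝ) : ℝ := s ^ (-p) + (1 - s) ^ (-p) - 1

/-- Both powers are at least 1, so either one is at most their sum minus 1. Subtracting 1 is
essential: the integral becomes `(1+p)/(1-p)`, which tends to 1 as `p → 0`, whereas `2/(1-p)` would
cost a factor `2^d` in the product. -/
theorem rpow_min_le_edgeWeight {p s : ℝ} (hp : 0 ≤ p) (hs : s ∈ Set.Ioo (0 : ℝ) 1) :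
    (min s (1 - s)) ^ (-p) ≤ edgeWeight p s := by
  have h1 := Real.one_le_rpow_of_pos_of_le_one_of_nonpos hs.1 hs.2.le (neg_nonpos.2 hp)
  have h2 := Real.one_le_rpow_of_pos_of_le_one_of_nonpos (sub_pos.2 hs.2)
    (sub_le_self 1 hs.1.le) (neg_nonpos.2 hp)
  rw [edgeWeight]
  rcases min_choice s (1 - s) with h | h <;> rw [h] <;> linarith

theorem integrable_rpow_neg {p : ℝ} (hp : p < 1) :
    Integrable (fun s : ℝ => s ^ (-p)) (volume.restrict (Set.Ioo (0 : ℝ) 1)) :=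
  (intervalIntegrable_iff_integrableOn_Ioo_of_le zero_le_one).1
    (intervalIntegral.intervalIntegrable_rpow' (by linarith))

theorem integrable_rpow_neg_reflect {p : ℝ} (hp : p < 1) :
    Integrable (fun s : ℝ => (1 - s) ^ (-p)) (volume.restrict (Set.Ioo (0 : ℝ) 1)) := by
  refine (intervalIntegrable_iff_integrableOn_Ioo_of_le zero_le_one).1 ?_
  have := (intervalIntegral.intervalIntegrable_rpow' (a := 0) (b := 1) (r := -p)
    (by linarith)).comp_sub_left 1
  simpa using this.symm

theorem integrable_edgeWeight {p : ℝ} (hp : p < 1) :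
    Integrable (edgeWeight p) (volume.restrict (Set.Ioo (0 : ℝ) 1)) :=
  ((integrable_rpow_neg hp).add (integrable_rpow_neg_reflect hp)).sub (integrable_const 1)

theorem integral_edgeWeight {p : ℝ} (hp : p < 1) :
    ∫ s in Set.Ioo (0 : ℝ) 1, edgeWeight p s = (1 + p) / (1 - p) := by
  have h1 : ∫ s in (0 : ℝ)..1, s ^ (-p) = 1 / (1 - p) := by
    rw [integral_rpow (Or.inl (by linarith)), Real.one_rpow, Real.zero_rpow (by linarith)]
    ring
  have h2 : ∫ s in (0 : ℝ)..1, (1 - s) ^ (-p) = 1 / (1 - p) := by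
    rw [intervalIntegral.integral_comp_sub_left (fun s : ℝ => s ^ (-p)) 1]
    simpa using h1
  rw [intervalIntegral.integral_of_le zero_le_one, integral_Ioc_eq_integral_Ioo] at h1 h2
  simp only [edgeWeight]
  rw [integral_sub (f := fun s : ℝ => s ^ (-p) + (1 - s) ^ (-p))
    ((integrable_rpow_neg hp).add (integrable_rpow_neg_reflect hp)) (integrable_const 1),
    integral_add (integrable_rpow_neg hp) (integrable_rpow_neg_reflect hp),
    h1, h2]
  have : 1 - p ≠ 0 := by linarith
  simp
  field_simp
  ring

theorem sixteen_mul_min_sq_le {s : ℝ} (hs : s ∈ Set.Icc (0 : ℝ) 1) :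
    16 * (min s (1 - s)) ^ 2 ≤ 4 * Real.sin (Real.pi * s) ^ 2 := by
  have hpi := Real.pi_pos
  have key (t : ℝ) (h0 : 0 ≤ t) (h1 : t ≤ 1 / 2) : 16 * t ^ 2 ≤ 4 * Real.sin (Real.pi * t) ^ 2 := by
    have h := Real.mul_le_sin (x := Real.pi * t) (by positivity) (by nlinarith)
    rw [show 2 / Real.pi * (Real.pi * t) = 2 * t by field_simp] at h
    nlinarith
  rcases le_total s (1 - s) with h | h
  · rw [min_eq_left h]
    exact key s hs.1 (by linarith)
  · rw [min_eq_right h, ← Real.sin_pi_sub, show Real.pi - Real.pi * s = Real.pi * (1 - s) by ring]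
    exact key (1 - s) (by linarith [hs.2]) (by linarith)

theorem min_pos_of_mem_Ioo {s : ℝ} (hs : s ∈ Set.Ioo (0 : ℝ) 1) : 0 < min s (1 - s) :=
  lt_min hs.1 (sub_pos.2 hs.2)

theorem inv_sq_rpow_inv_eq {y : ℝ} (hy : 0 ≤ y) (d : ℕ) :
    ((y ^ 2)⁻¹) ^ ((d : ℝ)⁻¹) = y ^ (-(2 / (d : ℝ))) := by
  rw [Real.inv_rpow (by positivity), ← Real.rpow_natCast, ← Real.rpow_mul hy, ← Real.rpow_neg hy]
  congr 1

theorem laplaceSymbol_pos {d : ℕ} (hd : 0 < d) {x : Fin d → ℝ}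
    (hx : ∀ j, x j ∈ Set.Ioo (0 : ℝ) 1) : 0 < laplaceSymbol x := by
  refine Finset.sum_pos (fun j _ => ?_) ⟨⟨0, hd⟩, mem_univ _⟩
  have h1 := sixteen_mul_min_sq_le (Set.Ioo_subset_Icc_self (hx j))
  have := min_pos_of_mem_Ioo (hx j)
  exact lt_of_lt_of_le (by positivity) h1

theorem inv_laplaceSymbol_le {d : ℕ} (hd : 0 < d) {x : Fin d → ℝ}
    (hx : ∀ j, x j ∈ Set.Ioo (0 : ℝ) 1) :
    (laplaceSymbol x)⁻¹ ≤ (16 * (d : ℝ))⁻¹ * ∏ j, edgeWeight (2 / d) (x j) := by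
  have hd' : (0 : ℝ) < d := by exact_mod_cast hd
  have hy (j : Fin d) := min_pos_of_mem_Ioo (hx j)
  have amgm := Real.geom_mean_le_arith_mean_weighted univ (fun _ : Fin d => (d : ℝ)⁻¹)
    (fun j => (min (x j) (1 - x j)) ^ 2) (fun _ _ => by positivity)
    (by simp [hd'.ne']) fun _ _ => by positivity
  rw [← Finset.mul_sum] at amgm
  have hsum : 16 * ∑ j, (min (x j) (1 - x j)) ^ 2 ≤ laplaceSymbol x := by
    rw [Finset.mul_sum]
    exact Finset.sum_le_sum fun j _ => sixteen_mul_min_sq_le (Set.Ioo_subset_Icc_self (hx j))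
  have hP : 0 < ∏ j, ((min (x j) (1 - x j)) ^ 2) ^ ((d : ℝ)⁻¹) :=
    Finset.prod_pos fun j _ => Real.rpow_pos_of_pos (pow_pos (hy j) 2) _
  have hle : 16 * d * ∏ j, ((min (x j) (1 - x j)) ^ 2) ^ ((d : ℝ)⁻¹) ≤ laplaceSymbol x := by
    refine le_trans ?_ hsum
    calc _ ≤ 16 * d * ((d : ℝ)⁻¹ * ∑ j, (min (x j) (1 - x j)) ^ 2) := by gcongr
      _ = _ := by field_simp
  calc (laplaceSymbol x)⁻¹
      ≤ (16 * d * ∏ j, ((min (x j) (1 - x j)) ^ 2) ^ ((d : ℝ)⁻¹))⁻¹ := by gcongr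
    _ = (16 * (d : ℝ))⁻¹ * ∏ j, (min (x j) (1 - x j)) ^ (-(2 / (d : ℝ))) := by
        rw [mul_inv, ← Finset.prod_inv_distrib]
        congr 1
        refine Finset.prod_congr rfl fun j _ => ?_
        rw [← Real.inv_rpow (by positivity), inv_sq_rpow_inv_eq (hy j).le]
    _ ≤ _ := by
        gcongr with j _
        · exact fun j _ => (Real.rpow_pos_of_pos (hy j) _).le
        · exact rpow_min_le_edgeWeight (by positivity) (hx j)

/-- Rounding down can send coordinate `j` to 0. Then `y_j ≤ 1/n`, and coordinate `i`, rounded into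
`[1/n, 1 - 1/n]`, supplies the bound. Otherwise rounding at most halves `x_j`, so the distance to
the nearest endpoint stays at least `y_j / 2`; this turns 16 into 4. -/
theorem four_mul_min_sq_le_laplaceSymbol_floor {d n : ℕ} {x : Fin d → ℝ}
    (hx : ∀ j, x j ∈ Set.Ioo (0 : ℝ) 1) {i : Fin d} (hi : ⌊x i * n⌋₊ ≠ 0) (j : Fin d) :
    4 * (min (x j) (1 - x j)) ^ 2 ≤ laplaceSymbol fun j => (⌊x j * n⌋₊ : ℝ) / n := by
  have hn0 : n ≠ 0 := by
    rintro rfl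
    simp at hi
  have hn : (0 : ℝ) < n := by exact_mod_cast Nat.pos_of_ne_zero hn0
  have hfl (l : Fin d) : (⌊x l * n⌋₊ : ℝ) ≤ x l * n :=
    Nat.floor_le (mul_nonneg (hx l).1.le hn.le)
  have hlt (l : Fin d) : (⌊x l * n⌋₊ : ℝ) + 1 ≤ n := by
    have : ⌊x l * n⌋₊ < n := by
      rw [Nat.floor_lt (mul_nonneg (hx l).1.le hn.le)]
      nlinarith [(hx l).2]
    exact_mod_cast this
  have hone (l : Fin d) (hl : ⌊x l * n⌋₊ ≠ 0) : (1 : ℝ) ≤ ⌊x l * n⌋₊ := by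
    exact_mod_cast Nat.one_le_iff_ne_zero.2 hl
  have term (l : Fin d) (t : ℝ) (ht : 0 ≤ t) (h1 : t ≤ (⌊x l * n⌋₊ : ℝ) / n)
      (h2 : t ≤ 1 - (⌊x l * n⌋₊ : ℝ) / n) :
      16 * t ^ 2 ≤ laplaceSymbol fun j => (⌊x j * n⌋₊ : ℝ) / n := by
    have hs : (⌊x l * n⌋₊ : ℝ) / n ∈ Set.Icc (0 : ℝ) 1 := ⟨ht.trans h1, by linarith⟩
    have h3 := sixteen_mul_min_sq_le hs
    have h4 : 16 * t ^ 2 ≤ 16 * (min ((⌊x l * n⌋₊ : ℝ) / n) (1 - (⌊x l * n⌋₊ : ℝ) / n)) ^ 2 := by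
      gcongr
      exact le_min h1 h2
    refine (h4.trans h3).trans ?_
    exact Finset.single_le_sum (f := fun j => 4 * Real.sin (Real.pi * ((⌊x j * n⌋₊ : ℝ) / n)) ^ 2)
      (fun _ _ => by positivity) (mem_univ l)
  have hy := min_pos_of_mem_Ioo (hx j)
  have hy1 := min_le_left (x j) (1 - x j)
  have hy2 := min_le_right (x j) (1 - x j)
  by_cases hj : ⌊x j * n⌋₊ = 0
  · have hxj : x j * n < 1 := Nat.floor_eq_zero.1 hj
    have hyn : min (x j) (1 - x j) ≤ 1 / n := by
      rw [le_div_iff₀ hn]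
      nlinarith
    have := term i _ hy.le (hyn.trans (by gcongr; exact hone i hi)) (hyn.trans (by
      rw [le_sub_iff_add_le, ← add_div, div_le_one hn]
      linarith [hlt i]))
    nlinarith
  · have hgt := Nat.lt_floor_add_one (x j * n)
    have := term j (min (x j) (1 - x j) / 2) (by positivity)
      (by
        rw [le_div_iff₀ hn]
        nlinarith [hone j hj])
      (by
        have : (⌊x j * n⌋₊ : ℝ) / n ≤ x j := by
          rw [div_le_iff₀ hn]
          exact hfl j
        linarith)
    nlinarith

/-- Every `y_j²` is at most the rounded symbol `S`, so splitting `S⁻¹` into `d` equal factors bounds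
each by `y_j^{-2/d}`, uniformly in `n`. If all coordinates round to 0, then `S⁻¹ = 0`. -/
theorem inv_laplaceSymbol_floor_le {d : ℕ} (hd : 0 < d) (n : ℕ) {x : Fin d → ℝ}
    (hx : ∀ j, x j ∈ Set.Ioo (0 : ℝ) 1) :
    (laplaceSymbol fun j => (⌊x j * n⌋₊ : ℝ) / n)⁻¹ ≤ ∏ j, edgeWeight (2 / d) (x j) := by
  have hd' : (0 : ℝ) < d := by exact_mod_cast hd
  have hy (j : Fin d) := min_pos_of_mem_Ioo (hx j)
  have hw (j : Fin d) := rpow_min_le_edgeWeight (p := 2 / d) (by positivity) (hx j)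
  by_cases h : ∀ i, ⌊x i * n⌋₊ = 0
  · have h0 : laplaceSymbol (fun j => (⌊x j * n⌋₊ : ℝ) / n) = 0 := by simp [laplaceSymbol, h]
    rw [h0, inv_zero]
    exact Finset.prod_nonneg fun j _ => (Real.rpow_pos_of_pos (hy j) _).le.trans (hw j)
  · push Not at h
    obtain ⟨i, hi⟩ := h
    have hb := four_mul_min_sq_le_laplaceSymbol_floor hx hi
    set S := laplaceSymbol fun j => (⌊x j * n⌋₊ : ℝ) / n
    have hS : 0 < S := lt_of_lt_of_le (by have := hy i; positivity) (hb i)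
    have hSp : S⁻¹ = ∏ _j : Fin d, (S⁻¹) ^ ((d : ℝ)⁻¹) := by
      rw [Finset.prod_const, card_univ, Fintype.card_fin,
        Real.rpow_inv_natCast_pow (inv_nonneg.2 hS.le) hd.ne']
    rw [hSp]
    refine Finset.prod_le_prod (fun j _ => by positivity) fun j _ => ?_
    refine le_trans ?_ (hw j)
    rw [← inv_sq_rpow_inv_eq (hy j).le]
    have := hy j
    gcongr
    nlinarith [hb j]

theorem continuous_laplaceSymbol {d : ℕ} : Continuous (laplaceSymbol (ι := Fin d)) := by
  unfold laplaceSymbol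
  fun_prop

theorem integrable_prod_edgeWeight {d : ℕ} (hd : 3 ≤ d) :
    Integrable (fun x : Fin d → ℝ => ∏ j, edgeWeight (2 / d) (x j)) (cubeMeasure d) := by
  refine Integrable.fintype_prod (f := fun _ => edgeWeight (2 / d)) fun _ =>
    integrable_edgeWeight ?_
  have : (3 : ℝ) ≤ d := by exact_mod_cast hd
  rw [div_lt_one (by linarith)]
  linarith

theorem integrable_inv_laplaceSymbol {d : ℕ} (hd : 3 ≤ d) :
    Integrable (fun x => (laplaceSymbol x)⁻¹) (cubeMeasure d) := by
  refine ((integrable_prod_edgeWeight hd).const_mul (16 * (d : ℝ))⁻¹).mono'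
    continuous_laplaceSymbol.measurable.inv.aestronglyMeasurable ?_
  filter_upwards [ae_mem_cube d] with x hx
  rw [Real.norm_of_nonneg (inv_nonneg.2 (laplaceSymbol_nonneg x))]
  exact inv_laplaceSymbol_le (by omega) hx

open Filter Topology in
theorem tendsto_averageResistance {d : ℕ} (hd : 3 ≤ d) :
    Tendsto (fun M : ℕ+ => averageResistance (cubicTorus d M)) atTop
      (𝓝 (∫ x, (laplaceSymbol x)⁻¹ ∂cubeMeasure d)) := by
  have hlim : Tendsto (fun n : ℕ => ∫ x : Fin d → ℝ,
      (laplaceSymbol fun j => (⌊x j * n⌋₊ : ℝ) / n)⁻¹ ∂cubeMeasure d) atTop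
      (𝓝 (∫ x, (laplaceSymbol x)⁻¹ ∂cubeMeasure d)) := by
    refine tendsto_integral_of_dominated_convergence
      (fun x => ∏ j, edgeWeight (2 / d) (x j)) (fun n => ?_) (integrable_prod_edgeWeight hd)
      (fun n => ?_) ?_
    · refine Measurable.aestronglyMeasurable (Measurable.inv ?_)
      refine continuous_laplaceSymbol.measurable.comp (measurable_pi_lambda _ fun j => ?_)
      exact (measurable_from_nat.comp (Nat.measurable_floor.comp
        ((measurable_pi_apply j).mul_const _))).div_const _
    · filter_upwards [ae_mem_cube d] with x hx
      rw [Real.norm_of_nonneg (inv_nonneg.2 (laplaceSymbol_nonneg _))]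
      exact inv_laplaceSymbol_floor_le (by omega) n hx
    · filter_upwards [ae_mem_cube d] with x hx
      refine Tendsto.inv₀ ?_ (laplaceSymbol_pos (by omega) hx).ne'
      refine (continuous_laplaceSymbol.tendsto x).comp (tendsto_pi_nhds.2 fun j => ?_)
      exact (tendsto_nat_floor_mul_div_atTop (hx j).1.le).comp tendsto_natCast_atTop_atTop
  refine (hlim.comp tendsto_PNat_val_atTop_atTop).congr' ?_
  filter_upwards [eventually_ge_atTop (3 : ℕ+)] with M hM
  rw [averageResistance_cubicTorus (by exact_mod_cast hM)]
  exact integral_floor_eq_sum (n := M) fun k => (laplaceSymbol fun j => (k j : ℝ) / (M : ℕ))⁻¹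

theorem one_div_le_integral {d : ℕ} (hd : 3 ≤ d) :
    1 / 4 * (1 / (d : ℝ)) ≤ ∫ x, (laplaceSymbol x)⁻¹ ∂cubeMeasure d := by
  have h : ∫ _x, 1 / 4 * (1 / (d : ℝ)) ∂cubeMeasure d ≤
      ∫ x, (laplaceSymbol x)⁻¹ ∂cubeMeasure d := by
    refine integral_mono_ae (integrable_const _) (integrable_inv_laplaceSymbol hd) ?_
    filter_upwards [ae_mem_cube d] with x hx
    have h1 := laplaceSymbol_pos (by omega) hx
    have h2 := laplaceSymbol_le x
    rw [Fintype.card_fin] at h2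
    rw [one_div_mul_one_div, one_div]
    gcongr
  simpa using h

theorem integral_le_one_div {d : ℕ} (hd : 3 ≤ d) :
    ∫ x, (laplaceSymbol x)⁻¹ ∂cubeMeasure d ≤ Real.exp 12 / 16 * (1 / (d : ℝ)) := by
  have hd' : (3 : ℝ) ≤ d := by exact_mod_cast hd
  have hp : 2 / (d : ℝ) < 1 := by
    rw [div_lt_one (by linarith)]
    linarith
  have h : ∫ x, (laplaceSymbol x)⁻¹ ∂cubeMeasure d ≤
      ∫ x, (16 * (d : ℝ))⁻¹ * ∏ j, edgeWeight (2 / d) (x j) ∂cubeMeasure d := by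
    refine integral_mono_ae (integrable_inv_laplaceSymbol hd)
      ((integrable_prod_edgeWeight hd).const_mul _) ?_
    filter_upwards [ae_mem_cube d] with x hx
    exact inv_laplaceSymbol_le (by omega) hx
  refine h.trans ?_
  rw [integral_const_mul, cubeMeasure, integral_fintype_prod_eq_pow (edgeWeight (2 / d)),
    integral_edgeWeight hp, Fintype.card_fin]
  have hexp : ((1 + 2 / (d : ℝ)) / (1 - 2 / d)) ^ d ≤ Real.exp 12 := by
    -- With `p = 2/d`, `(1+p)/(1-p) ≤ 1 + 6p` holds for `0 ≤ p ≤ 2/3`, that is, for `d ≥ 3`. Then `1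
    -- + 6p ≤ exp(12/d)`, whose `d`-th power is `exp 12`.
    have h1 : (1 + 2 / (d : ℝ)) / (1 - 2 / d) ≤ Real.exp (12 / d) := by
      refine le_trans ?_ (Real.add_one_le_exp _)
      rw [div_le_iff₀ (by linarith)]
      have : 2 / (d : ℝ) ≤ 2 / 3 := by gcongr
      have h3 : 12 / (d : ℝ) = 6 * (2 / d) := by ring
      have h4 : 0 ≤ 2 / (d : ℝ) := by positivity
      rw [h3]
      nlinarith
    calc _ ≤ (Real.exp (12 / d)) ^ d := by
          gcongr
      _ = Real.exp 12 := by
        rw [← Real.exp_nat_mul]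
        congr 1
        field_simp
  calc _ ≤ (16 * (d : ℝ))⁻¹ * Real.exp 12 := by gcongr
    _ = _ := by
      rw [mul_inv]
      ring

open Filter Asymptotics in
theorem integral_isTheta :
    (fun d : ℕ => ∫ x, (laplaceSymbol x)⁻¹ ∂cubeMeasure d) =Θ[atTop]
      fun d : ℕ => 1 / (d : ℝ) := by
  have hnn (d : ℕ) : 0 ≤ ∫ x, (laplaceSymbol x)⁻¹ ∂cubeMeasure d :=
    integral_nonneg fun x => inv_nonneg.2 (laplaceSymbol_nonneg x)
  constructor
  · refine IsBigO.of_bound (Real.exp 12 / 16) ?_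
    filter_upwards [eventually_ge_atTop 3] with d hd
    rw [Real.norm_of_nonneg (hnn d), Real.norm_of_nonneg (by positivity)]
    exact integral_le_one_div hd
  · refine IsBigO.of_bound 4 ?_
    filter_upwards [eventually_ge_atTop 3] with d hd
    rw [Real.norm_of_nonneg (hnn d), Real.norm_of_nonneg (by positivity)]
    linarith [one_div_le_integral hd]

end ToroidalGrid

open Filter Topology Asymptotics ToroidalGrid in
theorem theorem1 :
    ((fun M : ℕ+ => averageResistance (cubicTorus 2 M)) ~[atTop]
      fun M : ℕ+ => 1 / (2 * Real.pi) * Real.log (M : ℝ)) ∧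
    ∃ L : ℕ → ℝ,
      (∀ d : ℕ, 3 ≤ d →
        Tendsto (fun M : ℕ+ => averageResistance (cubicTorus d M)) atTop (𝓝 (L d))) ∧
      L =Θ[atTop] fun d : ℕ => 1 / (d : ℝ) :=
  ⟨averageResistance_two_isEquivalent, fun d => ∫ x, (laplaceSymbol x)⁻¹ ∂cubeMeasure d,
    fun _ hd => tendsto_averageResistance hd, integral_isTheta⟩
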